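/- Let $n\ge 1$. For an increasing (nondecreasing) function $\Phi:[0,\infty]\to[0,\infty]$ put $a(\Phi)=\sup\{t\ge0:\Phi(t)=0\}$ and $b(\Phi)=\inf\{t\ge0:\Phi(t)=\infty\}$ (with $\sup\emptyset=0$, $\inf\emptyset=\infty$). Let $\overline{\varPhi}$ be the set of all increasing $\Phi:[0,\infty]\to[0,\infty]$ such that $a(\Phi)<\infty$, $b(\Phi)>0$, $\lim_{t\to+0}\Phi(t)=\Phi(0)=0$, $\Phi$ is left continuous on $[0,b(\Phi))$, $\lim_{t\to\infty}\Phi(t)=\Phi(\infty)=\infty$ if $b(\Phi)=\infty$, and $\lim_{t\to b(\Phi)-0}\Phi(t)=\Phi(b(\Phi))\ (\le\infty)$ if $b(\Phi)<\infty$. A *Young function* is a $\Psi\in\overline{\varPhi}$ that is convex on $[0,b(\Psi))$. A *generalized Young function* is a $\Phi\in\overline{\varPhi}$ for which there are a Young function $\Psi$ and a constant $C>0$ with $\Phi(C^{-1}t)\le\Psi(t)\le\Phi(Ct)$ for all $t\in[0,\infty]$. We write $\Phi\in\overline\nabla_2$ if $\Phi\in\overline{\varPhi}$ and there is $k>1$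 with $\Phi(t)\le\frac1{2k}\Phi(kt)$ for all $t>0$. Let $\mathcal G^{\rm dec}$ be the set of all $\varphi:(0,\infty)\to(0,\infty)$ for which there is $C>0$ with $\varphi(s)\le C\varphi(r)$ and $\varphi(r)r^n\le C\varphi(s)s^n$ whenever $0<r<s$. For a ball $B=B(a,r)\subset\mathbb R^n$ and a measurable function $f$ on $\mathbb R^n$ let $$\|f\|_{\Phi,\varphi,B}=\inf\Big\{\lambda>0:\frac1{\varphi(r)|B|}\int_B\Phi\Big(\frac{|f(x)|}{\lambda}\Big)dx\le1\Big\},$$ $$\|f\|_{\Phi,\varphi,B,\mathrm{weak}}=\inf\Big\{\lambda>0:\sup_{t\in(0,\infty)}\frac{\Phi(t)\,|\{x\in B:|f(x)|/\lambda>t\}|}{|B|\varphi(r)}\le1\Big\},$$ and let $\|f\|_{L^{(\Phi,\varphi)}}=\sup_B\|f\|_{\Phi,\varphi,B}$ and $\|f\|_{\mathrm wL^{(\Phi,\varphi)}}=\sup_B\|f\|_{\Phi,\varphi,B,\mathrm{weak}}$, the suprema being over all open balls. The Orlicz–Morrey space $L^{(\Phi,\varphi)}(\mathbb R^n)$ and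 the weak Orlicz–Morrey space $\mathrm wL^{(\Phi,\varphi)}(\mathbb R^n)$ consist of the measurable functions for which these quantities, respectively, are finite. Let $Mf(x)=\sup_{B\ni x}\frac1{|B|}\int_B|f(y)|\,dy$ be the Hardy–Littlewood maximal function, the supremum being over all open balls $B$ containing $x$. **Theorem.** Let $\Phi$ be a generalized Young function and $\varphi\in\mathcal G^{\rm dec}$. Then $M$ is bounded from $L^{(\Phi,\varphi)}(\mathbb R^n)$ to $\mathrm wL^{(\Phi,\varphi)}(\mathbb R^n)$: there is a constant $C>0$, independent of $f$, such that for all $f\in L^{(\Phi,\varphi)}(\mathbb R^n)$ one has $Mf\in\mathrm wL^{(\Phi,\varphi)}(\mathbb R^n)$ and $\|Mf\|_{\mathrm wL^{(\Phi,\varphi)}}\le C\|f\|_{L^{(\Phi,\varphi)}}$. If moreover $\Phi\in\overline\nabla_2$, then $M$ is bounded in the same sense from $L^{(\Phi,\varphi)}(\mathbb R^n)$ to itself and from $\mathrm wL^{(\Phi,\varphi)}(\mathbb R^n)$ to itself. -/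

import Mathlib

open MeasureTheory Set Filter Topology
open scoped ENNReal NNReal

namespace OrliczMorrey

noncomputable section

/-- `a(Φ) = sup {t ≥ 0 : Φ t = 0}`. -/
def lowerEnd (Φ : ℝ≥0∞ → ℝ≥0∞) : ℝ≥0∞ := sSup {t | Φ t = 0}

/-- `b(Φ) = inf {t ≥ 0 : Φ t = ∞}`, with `inf ∅ = ∞`. -/
def upperEnd (Φ : ℝ≥0∞ → ℝ≥0∞) : ℝ≥0∞ := sInf {t | Φ t = ∞}

/-- The class of increasing functions `Φ : [0,∞] → [0,∞]` among which the (generalized) Young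
functions are singled out. -/
structure IsPhi (Φ : ℝ≥0∞ → ℝ≥0∞) : Prop where
  monotone : Monotone Φ
  lowerEnd_lt_top : lowerEnd Φ < ∞
  upperEnd_pos : 0 < upperEnd Φ
  map_zero : Φ 0 = 0
  tendsto_zero : Tendsto Φ (𝓝[>] 0) (𝓝 0)
  leftCont : ∀ t < upperEnd Φ, ContinuousWithinAt Φ (Iio t) t
  of_upperEnd_eq_top : upperEnd Φ = ∞ → Φ ∞ = ∞ ∧ Tendsto Φ (𝓝[<] ∞) (𝓝 ∞)
  of_upperEnd_lt_top : upperEnd Φ < ∞ →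
    Tendsto Φ (𝓝[<] (upperEnd Φ)) (𝓝 (Φ (upperEnd Φ)))

/-- Young functions: convex on `[0, b(Φ))`. -/
structure IsYoung (Φ : ℝ≥0∞ → ℝ≥0∞) : Prop extends IsPhi Φ where
  convexOn : ConvexOn ℝ≥0 (Iio (upperEnd Φ)) Φ

/-- `Φ ≈ Ψ`: `Φ(C⁻¹ t) ≤ Ψ(t) ≤ Φ(C t)` for all `t ∈ [0,∞]` and some constant `C > 0`. -/
def Equivalent (Φ Ψ : ℝ≥0∞ → ℝ≥0∞) : Prop :=
  ∃ C : ℝ≥0, 0 < C ∧ ∀ t : ℝ≥0∞, Φ ((C : ℝ≥0∞)⁻¹ * t) ≤ Ψ t ∧ Ψ t ≤ Φ (C * t)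

/-- Generalized Young functions. -/
def IsGenYoung (Φ : ℝ≥0∞ → ℝ≥0∞) : Prop :=
  IsPhi Φ ∧ ∃ Ψ, IsYoung Ψ ∧ Equivalent Φ Ψ

/-- The `∇₂`-condition `Φ(t) ≤ Φ(k t) / (2 k)`, `t > 0`, for some `k > 1`. -/
def Nabla2 (Φ : ℝ≥0∞ → ℝ≥0∞) : Prop :=
  IsPhi Φ ∧ ∃ k : ℝ≥0, 1 < k ∧ ∀ t : ℝ≥0∞, 0 < t → Φ t ≤ (2 * k : ℝ≥0∞)⁻¹ * Φ (k * t)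

/-- The class `𝒢^dec` in dimension `n`. Only the restriction of `φ` to `(0,∞)` matters. -/
def GDec (n : ℕ) (φ : ℝ → ℝ) : Prop :=
  (∀ r, 0 < r → 0 < φ r) ∧
  ∃ C : ℝ, 0 < C ∧ ∀ r s : ℝ, 0 < r → r < s →
    φ s ≤ C * φ r ∧ φ r * r ^ n ≤ C * (φ s * s ^ n)

section Spaces

variable {n : ℕ} {ε : Type*}

/-- `‖f‖_{Φ,φ,B}` for the ball `B = B(a,r)` (it is `∞` if no `lam` is admissible). -/
def ballNorm [ENorm ε] (Φ : ℝ≥0∞ → ℝ≥0∞) (φ : ℝ → ℝ) (a : EuclideanSpace ℝ (Fin n)) (r : ℝ)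
    (f : EuclideanSpace ℝ (Fin n) → ε) : ℝ≥0∞ :=
  sInf {lam : ℝ≥0∞ | 0 < lam ∧ lam < ∞ ∧
    (ENNReal.ofReal (φ r))⁻¹ *
      ((volume (Metric.ball a r))⁻¹ * ∫⁻ x in Metric.ball a r, Φ (‖f x‖ₑ / lam)) ≤ 1}

/-- `‖f‖_{Φ,φ,B,weak}` for the ball `B = B(a,r)`. -/
def ballWeakNorm [ENorm ε] (Φ : ℝ≥0∞ → ℝ≥0∞) (φ : ℝ → ℝ) (a : EuclideanSpace ℝ (Fin n)) (r : ℝ)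
    (f : EuclideanSpace ℝ (Fin n) → ε) : ℝ≥0∞ :=
  sInf {lam : ℝ≥0∞ | 0 < lam ∧ lam < ∞ ∧
    (⨆ t ∈ Ioo (0 : ℝ≥0∞) ∞,
      Φ t * volume {x ∈ Metric.ball a r | t < ‖f x‖ₑ / lam} /
        (volume (Metric.ball a r) * ENNReal.ofReal (φ r))) ≤ 1}

/-- The Orlicz–Morrey (quasi-)norm: the supremum over all balls. -/
def omNorm [ENorm ε] (Φ : ℝ≥0∞ → ℝ≥0∞) (φ : ℝ → ℝ)
    (f : EuclideanSpace ℝ (Fin n) → ε) : ℝ≥0∞ :=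
  ⨆ (a : EuclideanSpace ℝ (Fin n)) (r : ℝ) (_ : 0 < r), ballNorm Φ φ a r f

/-- The weak Orlicz–Morrey quasi-norm: the supremum over all balls. -/
def omWeakNorm [ENorm ε] (Φ : ℝ≥0∞ → ℝ≥0∞) (φ : ℝ → ℝ)
    (f : EuclideanSpace ℝ (Fin n) → ε) : ℝ≥0∞ :=
  ⨆ (a : EuclideanSpace ℝ (Fin n)) (r : ℝ) (_ : 0 < r), ballWeakNorm Φ φ a r f

/-- `f ∈ L^{(Φ,φ)}(ℝⁿ)`: `f` is Lebesgue measurable and its Orlicz–Morrey norm is finite. -/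
def MemOM [TopologicalSpace ε] [ENorm ε] (Φ : ℝ≥0∞ → ℝ≥0∞) (φ : ℝ → ℝ)
    (f : EuclideanSpace ℝ (Fin n) → ε) : Prop :=
  AEStronglyMeasurable f volume ∧ omNorm Φ φ f < ∞

/-- `f ∈ wL^{(Φ,φ)}(ℝⁿ)`. -/
def MemWeakOM [TopologicalSpace ε] [ENorm ε] (Φ : ℝ≥0∞ → ℝ≥0∞) (φ : ℝ → ℝ)
    (f : EuclideanSpace ℝ (Fin n) → ε) : Prop :=
  AEStronglyMeasurable f volume ∧ omWeakNorm Φ φ f < ∞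

/-- The (uncentered) Hardy–Littlewood maximal function, with values in `[0,∞]`:
the supremum of the averages of `|f|` over all open balls containing `x`. -/
def maximal [ENorm ε] (f : EuclideanSpace ℝ (Fin n) → ε) (x : EuclideanSpace ℝ (Fin n)) : ℝ≥0∞ :=
  ⨆ (a : EuclideanSpace ℝ (Fin n)) (r : ℝ) (_ : x ∈ Metric.ball a r),
    (volume (Metric.ball a r))⁻¹ * ∫⁻ y in Metric.ball a r, ‖f y‖ₑ

end Spaces

end

end OrliczMorrey

/-!
For `lam` above the norm of `f`, put `g = |f| / lam`. Finiteness of the norms becomes a bound on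
`Φ` of `g` over balls (`StrongModular`, `WeakModular`), and constants are absorbed into the argument
of `Φ`. What a generalized Young function contributes, besides monotonicity and its behaviour at
`0` and `∞`, is that `Φ(t) / t` is nondecreasing up to a dilation (`QuasiSuperlinear`), which
convexity of an equivalent Young function provides.

The pivot is the tail bound `Φ(t) ∫_{B, g > t} g ≤ K t |B| φ(r)` on all balls `B` of radius `r`
(`TailBound`). It follows from the strong modular condition by quasi-superlinearity, and, under
`∇₂`, from the weak modular condition by summing a geometric series over the levels `k ^ j t`.

If a ball `B'` has average of `g` above `2 t`, then `t |B'| ≤ ∫_{B', g > t} g`. When `B'` meets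
`B = B(a,r)` and has radius larger than `r`, the tail bound and the almost decrease of `φ` force
`Φ(t) ≤ K A φ(r)`. For all larger values of `Φ(t)`, the set `{x ∈ B : M g > 2 t}` is therefore
covered by balls of radius at most `r`, and Vitali's covering lemma inside `B(a,3r)` gives
`t |{x ∈ B : M g > 2 t}| ≤ 5 ^ n ∫_{B(a,3r), g > t} g` (`TailBound.mul_volume_le`).

Together with the tail bound on `B(a,3r)` this is the weak estimate for `M g`. For the strong one,
the same inequality is multiplied by `Φ(t) / t` and summed over the levels `t = k ^ j`; by `∇₂`
the sum `∑ Φ(k ^ j) k ^ (-j) g 1_{g > k ^ j}` is at most `2 k Φ(g)` (`tsum_upperPart_le`), which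
bounds `∫_B Φ(M g / (2 k))` by the modular of `g` on `B(a,3r)`.
-/

namespace OrliczMorrey

/-! ### Growth of generalized Young functions -/

lemma IsPhi.map_top {Φ : ℝ≥0∞ → ℝ≥0∞} (hΦ : IsPhi Φ) : Φ ∞ = ∞ := by
  rcases eq_or_ne (upperEnd Φ) ∞ with h | h
  · exact (hΦ.of_upperEnd_eq_top h).1
  · obtain ⟨t, ht, -⟩ := sInf_lt_iff.1 (lt_top_iff_ne_top.2 h)
    exact top_le_iff.1 (ht.symm.le.trans (hΦ.monotone le_top))

lemma IsPhi.eq_top_of_upperEnd_lt {Φ : ℝ≥0∞ → ℝ≥0∞} (hΦ : IsPhi Φ) {t : ℝ≥0∞}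
    (ht : upperEnd Φ < t) : Φ t = ∞ := by
  obtain ⟨s, hs, hst⟩ := sInf_lt_iff.1 ht
  exact top_le_iff.1 (hs.symm.le.trans (hΦ.monotone hst.le))

/-- Convexity and `Ψ 0 = 0` make `Ψ t / t` nondecreasing. Doubling the argument on the right
disposes of the endpoint `s = b(Ψ)`. -/
lemma IsYoung.mul_le {Ψ : ℝ≥0∞ → ℝ≥0∞} (hΨ : IsYoung Ψ) {t s : ℝ≥0∞} (hts : t ≤ s) :
    Ψ t * s ≤ t * Ψ (2 * s) := by
  rcases eq_or_ne t 0 with rfl | ht0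
  · simp [hΨ.map_zero]
  have hs0 : s ≠ 0 := (pos_iff_ne_zero.2 ht0).trans_le hts |>.ne'
  rcases eq_or_ne s ∞ with rfl | hs
  · simp [hΨ.toIsPhi.map_top, ht0]
  have ht : t ≠ ∞ := ne_top_of_le_ne_top hs hts
  rcases lt_or_ge s (upperEnd Ψ) with hb | hb
  · lift s to ℝ≥0 using hs
    lift t to ℝ≥0 using ht
    have hs0' : s ≠ 0 := by simpa using hs0
    have hts' : t ≤ s := by exact_mod_cast hts
    have hq : t / s ≤ 1 := div_le_one_of_le₀ hts' (zero_le)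
    have hconv : Ψ ((t / s : ℝ≥0) • (s : ℝ≥0∞) + (1 - t / s : ℝ≥0) • (0 : ℝ≥0∞)) ≤
        (t / s : ℝ≥0) • Ψ s + (1 - t / s : ℝ≥0) • Ψ 0 :=
      hΨ.convexOn.2 hb hΨ.upperEnd_pos zero_le zero_le (add_tsub_cancel_of_le hq)
    have e : ((t / s : ℝ≥0) • (s : ℝ≥0∞)) = t := by
      rw [ENNReal.smul_def, smul_eq_mul, ← ENNReal.coe_mul, div_mul_cancel₀ _ hs0']
    rw [e, smul_zero, add_zero, hΨ.map_zero, smul_zero, add_zero, ENNReal.smul_def,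
      smul_eq_mul] at hconv
    calc Ψ t * s ≤ ((t / s : ℝ≥0) * Ψ s) * s := by gcongr
      _ = ((t / s : ℝ≥0) * s) * Ψ s := by ring
      _ = t * Ψ s := by rw [← ENNReal.coe_mul, div_mul_cancel₀ _ hs0']
      _ ≤ t * Ψ (2 * s) := by
        gcongr
        exact hΨ.monotone (by rw [two_mul]; exact le_self_add)
  · have : upperEnd Ψ < 2 * s := hb.trans_lt (by
      rw [two_mul]; exact ENNReal.lt_add_right hs hs0)
    rw [hΨ.toIsPhi.eq_top_of_upperEnd_lt this, ENNReal.mul_top ht0]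
    exact le_top

/-- `Φ t / t` is nondecreasing up to a dilation of the argument by `c`. -/
def QuasiSuperlinear (Φ : ℝ≥0∞ → ℝ≥0∞) (c : ℝ≥0) : Prop :=
  1 ≤ c ∧ ∀ t s : ℝ≥0∞, t ≤ s → Φ t * s ≤ t * Φ (c * s)

lemma IsGenYoung.exists_quasiSuperlinear {Φ : ℝ≥0∞ → ℝ≥0∞} (hΦ : IsGenYoung Φ) :
    ∃ c, QuasiSuperlinear Φ c := by
  obtain ⟨hP, Ψ, hΨ, C, hC, hE⟩ := hΦ
  have hC0 : (C : ℝ≥0∞) ≠ 0 := by simpa using hC.ne'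
  refine ⟨max 1 (C * (2 * C)), le_max_left _ _, fun t s hts ↦ ?_⟩
  have h1 : Φ t ≤ Ψ (C * t) := by
    simpa [← mul_assoc, ENNReal.inv_mul_cancel hC0 ENNReal.coe_ne_top] using (hE (C * t)).1
  have h3 : Ψ (2 * (C * s)) ≤ Φ ((max 1 (C * (2 * C)) : ℝ≥0) * s) := by
    refine (hE _).2.trans (hP.monotone ?_)
    calc (C : ℝ≥0∞) * (2 * (C * s)) = ((C * (2 * C) : ℝ≥0) : ℝ≥0∞) * s := by push_cast; ring
      _ ≤ _ := by gcongr; exact le_max_right _ _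
  have h2 : Ψ (C * t) * (C * s) ≤ C * t * Ψ (2 * (C * s)) := hΨ.mul_le (by gcongr)
  have h4 : (C : ℝ≥0∞) * (Φ t * s) ≤ C * (t * Φ ((max 1 (C * (2 * C)) : ℝ≥0) * s)) :=
    calc (C : ℝ≥0∞) * (Φ t * s) ≤ C * (Ψ (C * t) * s) := by gcongr
      _ = Ψ (C * t) * (C * s) := by ring
      _ ≤ C * t * Ψ (2 * (C * s)) := h2
      _ ≤ C * t * Φ ((max 1 (C * (2 * C)) : ℝ≥0) * s) := by gcongr
      _ = _ := by ring
  exact (ENNReal.mul_le_mul_iff_right hC0 ENNReal.coe_ne_top).1 h4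

/-- A constant factor can be absorbed into the argument. -/
lemma QuasiSuperlinear.mul_le {Φ : ℝ≥0∞ → ℝ≥0∞} (hΦ : IsPhi Φ) {c : ℝ≥0}
    (hc : QuasiSuperlinear Φ c) {K : ℝ≥0} (hK : 1 ≤ K) (s : ℝ≥0∞) :
    K * Φ s ≤ Φ (c * K * s) := by
  rcases eq_or_ne s 0 with rfl | hs0
  · simp [hΦ.map_zero]
  rcases eq_or_ne s ∞ with rfl | hs
  · have : (c : ℝ≥0∞) * K ≠ 0 := by
      have h1 : c ≠ 0 := (zero_lt_one.trans_le hc.1).ne'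
      have h2 : K ≠ 0 := (zero_lt_one.trans_le hK).ne'
      simp [h1, h2]
    rw [ENNReal.mul_top this, hΦ.map_top]
    exact le_top
  have hs' : s ≤ K * s := le_mul_of_one_le_left (zero_le) (by exact_mod_cast hK)
  have h := hc.2 s (K * s) hs'
  rw [← mul_assoc (c : ℝ≥0∞)] at h
  refine (ENNReal.mul_le_mul_iff_right hs0 hs).1 (le_trans (le_of_eq ?_) h)
  ring

/-- `Φ` is unbounded on `[0,∞)`. -/
lemma QuasiSuperlinear.exists_lt {Φ : ℝ≥0∞ → ℝ≥0∞} (hΦ : IsPhi Φ) {c : ℝ≥0}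
    (hc : QuasiSuperlinear Φ c) {N : ℝ≥0∞} (hN : N ≠ ∞) : ∃ t, t ≠ ∞ ∧ N < Φ t := by
  obtain ⟨t, ht, ht'⟩ := exists_between hΦ.lowerEnd_lt_top
  have h0 : Φ t ≠ 0 := fun h ↦ (le_sSup (a := t) h).not_gt ht
  obtain ⟨m, hm⟩ := ENNReal.exists_nat_mul_gt h0 hN
  have hm1 : (1 : ℝ≥0) ≤ max 1 (m : ℝ≥0) := le_max_left _ _
  refine ⟨c * (max 1 (m : ℝ≥0) : ℝ≥0) * t, ?_, hm.trans_le ?_⟩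
  · exact ENNReal.mul_ne_top (ENNReal.mul_ne_top ENNReal.coe_ne_top ENNReal.coe_ne_top) ht'.ne
  · refine le_trans ?_ (hc.mul_le hΦ hm1 t)
    gcongr
    exact_mod_cast le_max_right _ _

/-- The form of the `∇₂`-condition used below, for `t = 0` as well. -/
lemma mul_le_of_nabla {Φ : ℝ≥0∞ → ℝ≥0∞} (hΦ : IsPhi Φ) {k : ℝ≥0} (hk : 1 < k)
    (h : ∀ t : ℝ≥0∞, 0 < t → Φ t ≤ (2 * k : ℝ≥0∞)⁻¹ * Φ (k * t)) (t : ℝ≥0∞) :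
    2 * k * Φ t ≤ Φ (k * t) := by
  rcases eq_or_ne t 0 with rfl | ht0
  · simp [hΦ.map_zero]
  have hk0 : (2 * k : ℝ≥0∞) ≠ 0 := by simp [(zero_lt_one.trans hk).ne']
  have hk1 : (2 * k : ℝ≥0∞) ≠ ∞ := ENNReal.mul_ne_top (by simp) ENNReal.coe_ne_top
  calc 2 * k * Φ t ≤ 2 * k * ((2 * k : ℝ≥0∞)⁻¹ * Φ (k * t)) := by
        gcongr; exact h t (pos_iff_ne_zero.2 ht0)
    _ = Φ (k * t) := by rw [← mul_assoc, ENNReal.mul_inv_cancel hk0 hk1, one_mul]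

lemma pow_mul_le_of_nabla {Φ : ℝ≥0∞ → ℝ≥0∞} {k : ℝ≥0}
    (h : ∀ t : ℝ≥0∞, 2 * k * Φ t ≤ Φ (k * t)) (t : ℝ≥0∞) (j : ℕ) :
    (2 * k) ^ j * Φ t ≤ Φ (k ^ j * t) := by
  induction j with
  | zero => simp
  | succ j ih =>
    calc (2 * k : ℝ≥0∞) ^ (j + 1) * Φ t = 2 * k * ((2 * k) ^ j * Φ t) := by ring
      _ ≤ 2 * k * Φ (k ^ j * t) := by gcongr
      _ ≤ Φ (k * (k ^ j * t)) := h _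
      _ = _ := by rw [← mul_assoc, ← pow_succ']

/-! ### Norms and modulars -/

section Norms

variable {n : ℕ} {ε : Type*} [ENorm ε] {Φ : ℝ≥0∞ → ℝ≥0∞} {φ : ℝ → ℝ}

local notation "E" => EuclideanSpace ℝ (Fin n)

/-- `∫_B Φ(g) ≤ |B| φ(r)` for every ball `B = B(a,r)`. -/
def StrongModular (Φ : ℝ≥0∞ → ℝ≥0∞) (φ : ℝ → ℝ) (g : E → ℝ≥0∞) : Prop :=
  ∀ a r, 0 < r → ∫⁻ x in Metric.ball a r, Φ (g x) ≤
    volume (Metric.ball a r) * ENNReal.ofReal (φ r)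

/-- `Φ(t) |{x ∈ B : g x > t}| ≤ |B| φ(r)` for every ball `B = B(a,r)` and `0 < t < ∞`. -/
def WeakModular (Φ : ℝ≥0∞ → ℝ≥0∞) (φ : ℝ → ℝ) (g : E → ℝ≥0∞) : Prop :=
  ∀ a r, 0 < r → ∀ t, 0 < t → t < ∞ → Φ t * volume {x ∈ Metric.ball a r | t < g x} ≤
    volume (Metric.ball a r) * ENNReal.ofReal (φ r)

lemma ballAverage_le_one_iff (hφ : ∀ r, 0 < r → 0 < φ r) (a : E) {r : ℝ} (hr : 0 < r)
    (I : ℝ≥0∞) :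
    (ENNReal.ofReal (φ r))⁻¹ * ((volume (Metric.ball a r))⁻¹ * I) ≤ 1 ↔
      I ≤ volume (Metric.ball a r) * ENNReal.ofReal (φ r) := by
  have h1 : ENNReal.ofReal (φ r) ≠ 0 := by simpa using hφ r hr
  have h2 : volume (Metric.ball a r) ≠ 0 := (Metric.measure_ball_pos _ _ hr).ne'
  have h3 : volume (Metric.ball a r) ≠ ∞ := measure_ball_lt_top.ne
  rw [mul_comm, ← div_eq_mul_inv, ENNReal.div_le_iff h1 ENNReal.ofReal_ne_top, one_mul, mul_comm,
    ← div_eq_mul_inv, ENNReal.div_le_iff h2 h3, mul_comm]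

lemma StrongModular.of_omNorm_lt (hΦ : Monotone Φ) (hφ : ∀ r, 0 < r → 0 < φ r) {f : E → ε}
    {lam : ℝ≥0∞} (h : omNorm Φ φ f < lam) : StrongModular Φ φ (fun x ↦ ‖f x‖ₑ / lam) := by
  intro a r hr
  have h1 : ballNorm Φ φ a r f < lam :=
    (le_iSup_of_le a (le_iSup_of_le r
      (le_iSup (fun _ : 0 < r ↦ ballNorm Φ φ a r f) hr))).trans_lt h
  obtain ⟨μ, ⟨-, -, hμ⟩, hlt⟩ := sInf_lt_iff.1 h1
  refine le_trans (lintegral_mono fun x ↦ hΦ ?_) ((ballAverage_le_one_iff hφ a hr _).1 hμ)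
  exact ENNReal.div_le_div_left hlt.le _

lemma StrongModular.omNorm_le (hφ : ∀ r, 0 < r → 0 < φ r) {f : E → ε}
    {lam : ℝ≥0∞} (h0 : 0 < lam) (h1 : lam < ∞)
    (h : StrongModular Φ φ (fun x ↦ ‖f x‖ₑ / lam)) : omNorm Φ φ f ≤ lam :=
  iSup_le fun a ↦ iSup_le fun r ↦ iSup_le fun hr ↦
    sInf_le ⟨h0, h1, (ballAverage_le_one_iff hφ a hr _).2 (h a r hr)⟩

lemma ballWeak_le_one_iff (hφ : ∀ r, 0 < r → 0 < φ r) (a : E) {r : ℝ} (hr : 0 < r)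
    (g : E → ℝ≥0∞) :
    (⨆ t ∈ Ioo (0 : ℝ≥0∞) ∞, Φ t * volume {x ∈ Metric.ball a r | t < g x} /
      (volume (Metric.ball a r) * ENNReal.ofReal (φ r))) ≤ 1 ↔
      ∀ t, 0 < t → t < ∞ → Φ t * volume {x ∈ Metric.ball a r | t < g x} ≤
        volume (Metric.ball a r) * ENNReal.ofReal (φ r) := by
  have h1 : ENNReal.ofReal (φ r) ≠ 0 := by simpa using hφ r hr
  have h2 : volume (Metric.ball a r) ≠ 0 := (Metric.measure_ball_pos _ _ hr).ne'
  have h3 : volume (Metric.ball a r) ≠ ∞ := measure_ball_lt_top.ne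
  simp only [iSup_le_iff, mem_Ioo, and_imp,
    ENNReal.div_le_iff (mul_ne_zero h2 h1) (ENNReal.mul_ne_top h3 ENNReal.ofReal_ne_top), one_mul]

lemma WeakModular.of_omWeakNorm_lt (hφ : ∀ r, 0 < r → 0 < φ r) {f : E → ε}
    {lam : ℝ≥0∞} (h : omWeakNorm Φ φ f < lam) : WeakModular Φ φ (fun x ↦ ‖f x‖ₑ / lam) := by
  intro a r hr t ht0 ht
  have h1 : ballWeakNorm Φ φ a r f < lam :=
    (le_iSup_of_le a (le_iSup_of_le r
      (le_iSup (fun _ : 0 < r ↦ ballWeakNorm Φ φ a r f) hr))).trans_lt h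
  obtain ⟨μ, ⟨-, -, hμ⟩, hlt⟩ := sInf_lt_iff.1 h1
  refine le_trans ?_ ((ballWeak_le_one_iff hφ a hr _).1 hμ t ht0 ht)
  gcongr
  exact ENNReal.div_le_div_left hlt.le _

lemma WeakModular.omWeakNorm_le (hφ : ∀ r, 0 < r → 0 < φ r) {f : E → ε}
    {lam : ℝ≥0∞} (h0 : 0 < lam) (h1 : lam < ∞)
    (h : WeakModular Φ φ (fun x ↦ ‖f x‖ₑ / lam)) : omWeakNorm Φ φ f ≤ lam :=
  iSup_le fun a ↦ iSup_le fun r ↦ iSup_le fun hr ↦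
    sInf_le ⟨h0, h1, (ballWeak_le_one_iff hφ a hr _).2 (h a r hr)⟩

/-! ### The maximal function -/

lemma lt_maximal_iff {f : E → ε} {x : E} {t : ℝ≥0∞} :
    t < maximal f x ↔ ∃ c ρ, x ∈ Metric.ball c ρ ∧
      t * volume (Metric.ball c ρ) < ∫⁻ y in Metric.ball c ρ, ‖f y‖ₑ := by
  simp only [maximal, lt_iSup_iff, exists_prop]
  refine exists_congr fun c ↦ exists_congr fun ρ ↦ and_congr_right fun hx ↦ ?_
  have h2 : volume (Metric.ball c ρ) ≠ 0 :=
    (Metric.measure_ball_pos _ _ (Metric.pos_of_mem_ball hx)).ne'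
  have h3 : volume (Metric.ball c ρ) ≠ ∞ := measure_ball_lt_top.ne
  rw [mul_comm _ (∫⁻ y in _, _), ← div_eq_mul_inv,
    ENNReal.lt_div_iff_mul_lt (Or.inl h2) (Or.inl h3)]

/-- The maximal function is lower semicontinuous, hence measurable even if `f` is not. -/
lemma measurable_maximal (f : E → ε) : Measurable (maximal f) := by
  refine LowerSemicontinuous.measurable (lowerSemicontinuous_iff_isOpen_preimage.2 fun t ↦ ?_)
  refine isOpen_iff_mem_nhds.2 fun x hx ↦ ?_
  obtain ⟨c, ρ, hxc, h⟩ := lt_maximal_iff.1 hx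
  filter_upwards [Metric.isOpen_ball.mem_nhds hxc] with y hy
  exact lt_maximal_iff.2 ⟨c, ρ, hy, h⟩

lemma maximal_div (f : E → ε) {lam : ℝ≥0∞} (h0 : lam ≠ 0) (x : E) :
    maximal (fun y ↦ ‖f y‖ₑ / lam) x = maximal f x / lam := by
  simp only [maximal, enorm_eq_self, div_eq_mul_inv, ENNReal.iSup_mul,
    lintegral_mul_const' _ _ (ENNReal.inv_ne_top.2 h0), mul_assoc]

end Norms

/-! ### The local weak type estimate -/

section Covering

variable {n : ℕ}

local notation "E" => EuclideanSpace ℝ (Fin n)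

lemma volume_ball_mul (a : E) (r : ℝ) {s : ℝ} (hs : 0 < s) :
    volume (Metric.ball a (s * r)) = ENNReal.ofReal s ^ n * volume (Metric.ball a r) := by
  rw [Measure.addHaar_ball_mul_of_pos volume a hs, finrank_euclideanSpace_fin,
    ENNReal.ofReal_pow hs.le, Measure.addHaar_ball_center volume a]

lemma volume_closedBall_mul (a : E) {r s : ℝ} (hr : 0 < r) (hs : 0 < s) :
    volume (Metric.closedBall a (s * r)) = ENNReal.ofReal s ^ n * volume (Metric.ball a r) := by
  rw [Measure.addHaar_closedBall volume a (by positivity), Measure.addHaar_ball_of_pos volume a hr,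
    finrank_euclideanSpace_fin, mul_pow, ENNReal.ofReal_mul (by positivity),
    ENNReal.ofReal_pow hs.le, mul_assoc]

/-- Vitali covering: the weak type `(1,1)` inequality for the maximal function formed with balls of
radius at most `r`, localized to `B(a,r)`. -/
lemma mul_volume_local_le (h : E → ℝ≥0∞) (t : ℝ≥0∞) (a : E) (r : ℝ) :
    t * volume {x ∈ Metric.ball a r | ∃ c ρ, ρ ≤ r ∧ x ∈ Metric.ball c ρ ∧
      t * volume (Metric.ball c ρ) ≤ ∫⁻ y in Metric.ball c ρ, h y} ≤
      5 ^ n * ∫⁻ y in Metric.ball a (3 * r), h y := by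
  set T : Set (E × ℝ) := {p | p.2 ≤ r ∧ 0 < p.2 ∧ Metric.ball p.1 p.2 ⊆ Metric.ball a (3 * r) ∧
    t * volume (Metric.ball p.1 p.2) ≤ ∫⁻ y in Metric.ball p.1 p.2, h y} with hT
  obtain ⟨u, huT, hdisj, hcov⟩ := Vitali.exists_disjoint_subfamily_covering_enlargement_closedBall
    T (fun p ↦ p.1) (fun p ↦ p.2) r (fun p hp ↦ hp.1) 5 (by norm_num)
  have hdisj' : u.PairwiseDisjoint fun p ↦ Metric.ball p.1 p.2 :=
    hdisj.mono fun p ↦ Metric.ball_subset_closedBall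
  have hcount : u.Countable := hdisj'.countable_of_isOpen (fun p _ ↦ Metric.isOpen_ball)
    fun p hp ↦ Metric.nonempty_ball.2 (huT hp).2.1
  have hsub : {x ∈ Metric.ball a r | ∃ c ρ, ρ ≤ r ∧ x ∈ Metric.ball c ρ ∧
      t * volume (Metric.ball c ρ) ≤ ∫⁻ y in Metric.ball c ρ, h y} ⊆
      ⋃ p ∈ u, Metric.closedBall p.1 (5 * p.2) := by
    rintro x ⟨hxa, c, ρ, hρ, hxc, hlt⟩
    have hmem : (c, ρ) ∈ T := by
      refine ⟨hρ, Metric.pos_of_mem_ball hxc, fun y hy ↦ ?_, hlt⟩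
      rw [Metric.mem_ball] at *
      have h1 := dist_triangle y c a
      have h2 := dist_triangle c x a
      rw [dist_comm c x] at h2
      linarith
    obtain ⟨p, hp, hp'⟩ := hcov _ hmem
    exact mem_biUnion hp (hp' (Metric.ball_subset_closedBall hxc))
  have hvol (p : E × ℝ) (hp : p ∈ u) : t * volume (Metric.closedBall p.1 (5 * p.2)) ≤
      5 ^ n * ∫⁻ y in Metric.ball p.1 p.2, h y := by
    have hp0 := (huT hp).2.1
    rw [volume_closedBall_mul p.1 hp0 (by norm_num), ENNReal.ofReal_ofNat, mul_left_comm]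
    gcongr
    exact (huT hp).2.2.2
  calc _ ≤ t * volume (⋃ p ∈ u, Metric.closedBall p.1 (5 * p.2)) := by gcongr
    _ ≤ t * ∑' p : u, volume (Metric.closedBall p.1.1 (5 * p.1.2)) := by
      gcongr; exact measure_biUnion_le volume hcount _
    _ = ∑' p : u, t * volume (Metric.closedBall p.1.1 (5 * p.1.2)) := ENNReal.tsum_mul_left.symm
    _ ≤ ∑' p : u, 5 ^ n * ∫⁻ y in Metric.ball p.1.1 p.1.2, h y :=
      ENNReal.tsum_le_tsum fun p ↦ hvol p p.2
    _ = 5 ^ n * ∫⁻ y in ⋃ p ∈ u, Metric.ball p.1 p.2, h y := by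
      rw [ENNReal.tsum_mul_left, lintegral_biUnion hcount (fun _ _ ↦ measurableSet_ball) hdisj']
    _ ≤ _ := by
      gcongr
      exact iUnion₂_subset fun p hp ↦ (huT hp).2.2.1

/-- The part of `g` above the level `t`, i.e. `g` times the indicator of `{g > t}`. -/
noncomputable def upperPart (t : ℝ≥0∞) (g : E → ℝ≥0∞) : E → ℝ≥0∞ := {x | t < g x}.indicator g

lemma upperPart_of_lt {t : ℝ≥0∞} {g : E → ℝ≥0∞} {x : E} (h : t < g x) :
    upperPart t g x = g x := indicator_of_mem (s := {x | t < g x}) h g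

lemma upperPart_of_le {t : ℝ≥0∞} {g : E → ℝ≥0∞} {x : E} (h : g x ≤ t) :
    upperPart t g x = 0 := indicator_of_notMem (s := {x | t < g x}) h.not_gt g

lemma aemeasurable_upperPart {t : ℝ≥0∞} {g : E → ℝ≥0∞} (hg : AEMeasurable g) :
    AEMeasurable (upperPart t g) :=
  hg.indicator₀ (nullMeasurableSet_lt aemeasurable_const hg)

/-- If the average of `g` over a ball exceeds `2 t`, at least half of it comes from `{g > t}`. -/
lemma mul_volume_le_lintegral_upperPart {g : E → ℝ≥0∞} {t : ℝ≥0∞} (ht : t ≠ ∞) (c : E) (ρ : ℝ)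
    (h : 2 * t * volume (Metric.ball c ρ) < ∫⁻ y in Metric.ball c ρ, g y) :
    t * volume (Metric.ball c ρ) ≤ ∫⁻ y in Metric.ball c ρ, upperPart t g y := by
  have h1 : ∫⁻ y in Metric.ball c ρ, g y ≤
      t * volume (Metric.ball c ρ) + ∫⁻ y in Metric.ball c ρ, upperPart t g y := by
    rw [← setLIntegral_const, ← lintegral_add_left measurable_const]
    refine lintegral_mono fun y ↦ ?_
    rcases lt_or_ge t (g y) with hy | hy
    · simp [upperPart_of_lt hy]
    · simpa [upperPart_of_le hy] using hy
  have h2 := h.le.trans h1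
  rw [two_mul, add_mul] at h2
  exact (ENNReal.add_le_add_iff_left
    (ENNReal.mul_ne_top ht measure_ball_lt_top.ne)).1 h2

end Covering

/-! ### Tail estimates -/

section Tail

variable {n : ℕ} {Φ : ℝ≥0∞ → ℝ≥0∞} {φ : ℝ → ℝ} {g : EuclideanSpace ℝ (Fin n) → ℝ≥0∞}

/-- `Φ(t) ∫_{B, g > t} g ≤ K t |B| φ(r)` for every ball `B = B(a,r)` and `0 < t < ∞`. -/
def TailBound (Φ : ℝ≥0∞ → ℝ≥0∞) (φ : ℝ → ℝ) (K : ℝ≥0)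
    (g : EuclideanSpace ℝ (Fin n) → ℝ≥0∞) : Prop :=
  ∀ a r, 0 < r → ∀ t, 0 < t → t < ∞ → Φ t * ∫⁻ x in Metric.ball a r, upperPart t g x ≤
    K * t * (volume (Metric.ball a r) * ENNReal.ofReal (φ r))

/-- On `{g > t}` quasi-superlinearity gives `Φ(t) g ≤ t Φ(c g)`, which takes the place of
Jensen's inequality. -/
lemma StrongModular.tailBound (hg : AEMeasurable g) {c : ℝ≥0} (hc : QuasiSuperlinear Φ c)
    (h : StrongModular Φ φ (fun x ↦ c * g x)) : TailBound Φ φ 1 g := by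
  intro a r hr t ht0 ht
  calc Φ t * ∫⁻ x in Metric.ball a r, upperPart t g x
      = ∫⁻ x in Metric.ball a r, Φ t * upperPart t g x :=
        (lintegral_const_mul'' _ (aemeasurable_upperPart hg).restrict).symm
    _ ≤ ∫⁻ x in Metric.ball a r, t * Φ (c * g x) := by
      refine lintegral_mono fun x ↦ ?_
      rcases lt_or_ge t (g x) with hx | hx
      · simpa [upperPart_of_lt hx] using hc.2 t (g x) hx.le
      · simp [upperPart_of_le hx]
    _ = t * ∫⁻ x in Metric.ball a r, Φ (c * g x) := lintegral_const_mul' _ _ ht.ne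
    _ ≤ t * (volume (Metric.ball a r) * ENNReal.ofReal (φ r)) := by gcongr; exact h a r hr
    _ = _ := by simp

lemma StrongModular.weakModular (hΦ : Monotone Φ) (hg : AEMeasurable g)
    (h : StrongModular Φ φ g) : WeakModular Φ φ g := by
  intro a r hr t _ _
  refine le_trans ?_ (h a r hr)
  have hm : AEMeasurable (fun x ↦ Φ (g x)) (volume.restrict (Metric.ball a r)) :=
    hΦ.measurable.comp_aemeasurable hg.restrict
  refine le_trans ?_ (mul_meas_ge_le_lintegral₀ hm (Φ t))
  refine mul_le_mul_right ?_ _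
  rw [Measure.restrict_apply' measurableSet_ball, inter_comm]
  exact measure_mono fun x hx ↦ ⟨hx.1, hΦ hx.2.le⟩

/-- If `k ^ J t < g x ≤ k ^ (J + 1) t` with `J ≥ 0`, the `J`-th term alone dominates `g x`. -/
lemma upperPart_le_tsum {k : ℝ≥0} (hk : 1 < k) {t : ℝ≥0∞} (ht0 : 0 < t) (ht : t < ∞)
    {x : EuclideanSpace ℝ (Fin n)} (hx : g x ≠ ∞) :
    upperPart t g x ≤ ∑' j : ℕ, {y | k ^ j * t < g y}.indicator (fun _ ↦ k ^ (j + 1) * t) x := by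
  rcases lt_or_ge t (g x) with h | h
  swap
  · simp [upperPart_of_le h]
  rw [upperPart_of_lt h]
  lift t to ℝ≥0 using ht.ne
  obtain ⟨u, hu⟩ : ∃ u : ℝ≥0, (u : ℝ≥0∞) = g x := ⟨_, ENNReal.coe_toNNReal hx⟩
  rw [← hu] at h ⊢
  have ht0' : 0 < t := by exact_mod_cast ht0
  have h' : 1 < u / t := (one_lt_div ht0').2 (by exact_mod_cast h)
  obtain ⟨J, hJ1, hJ2⟩ := exists_mem_Ioc_zpow (zero_lt_one.trans h') hk
  have hJ : 0 < J + 1 := (one_lt_zpow_iff_right₀ hk).1 (h'.trans_le hJ2)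
  lift J to ℕ using by omega
  rw [zpow_natCast, lt_div_iff₀ ht0'] at hJ1
  rw [div_le_iff₀ ht0'] at hJ2
  refine le_trans ?_ (ENNReal.le_tsum J)
  rw [indicator_of_mem]
  · exact_mod_cast hJ2
  · rw [mem_ofPred_eq, ← hu]
    exact_mod_cast hJ1

/-- Under `∇₂` the weak condition already controls the integrals `∫_{B, g > t} g`: the dyadic
pieces `g ∼ k ^ j t` contribute a geometric series. -/
lemma WeakModular.tailBound {k : ℝ≥0} (hk : 1 < k)
    (hΦk : ∀ t : ℝ≥0∞, 2 * k * Φ t ≤ Φ (k * t)) (hg : AEMeasurable g) (hfin : ∀ x, g x ≠ ∞)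
    (h : WeakModular Φ φ g) : TailBound Φ φ (2 * k) g := by
  intro a r hr t ht0 ht
  set V := volume (Metric.ball a r) * ENNReal.ofReal (φ r)
  have hmeas (j : ℕ) : NullMeasurableSet {y | k ^ j * t < g y} :=
    nullMeasurableSet_lt aemeasurable_const hg
  have hk0 : (k : ℝ≥0∞) ≠ 0 := by simp [(zero_lt_one.trans hk).ne']
  have hterm (j : ℕ) : Φ t * (k ^ (j + 1) * t *
      volume {x ∈ Metric.ball a r | k ^ j * t < g x}) ≤ k * t * V * 2⁻¹ ^ j := by
    have hkt : (k : ℝ≥0∞) ^ j * t < ∞ :=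
      ENNReal.mul_lt_top (ENNReal.pow_lt_top ENNReal.coe_lt_top) ht
    have hkt0 : 0 < (k : ℝ≥0∞) ^ j * t := ENNReal.mul_pos (pow_ne_zero _ hk0) ht0.ne'
    have h2 : (2⁻¹ : ℝ≥0∞) ^ j * 2 ^ j = 1 := by
      rw [← mul_pow, ENNReal.inv_mul_cancel (by simp) (by simp), one_pow]
    calc Φ t * (k ^ (j + 1) * t * volume {x ∈ Metric.ball a r | k ^ j * t < g x})
        = k * t * (k ^ j * Φ t * volume {x ∈ Metric.ball a r | k ^ j * t < g x}) *
            ((2⁻¹ : ℝ≥0∞) ^ j * 2 ^ j) := by rw [h2]; ring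
      _ = k * t * ((2 * k) ^ j * Φ t * volume {x ∈ Metric.ball a r | k ^ j * t < g x}) *
            2⁻¹ ^ j := by rw [mul_pow]; ring
      _ ≤ k * t * (Φ (k ^ j * t) * volume {x ∈ Metric.ball a r | k ^ j * t < g x}) *
            2⁻¹ ^ j := by gcongr; exact pow_mul_le_of_nabla hΦk t j
      _ ≤ k * t * V * 2⁻¹ ^ j := by gcongr; exact h a r hr _ hkt0 hkt
  calc Φ t * ∫⁻ x in Metric.ball a r, upperPart t g x
      ≤ Φ t * ∫⁻ x in Metric.ball a r,
          ∑' j : ℕ, {y | k ^ j * t < g y}.indicator (fun _ ↦ k ^ (j + 1) * t) x := by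
        gcongr with x
        exact upperPart_le_tsum hk ht0 ht (hfin x)
    _ = ∑' j : ℕ, Φ t * (k ^ (j + 1) * t *
          volume {x ∈ Metric.ball a r | k ^ j * t < g x}) := by
      rw [lintegral_tsum fun j ↦ (aemeasurable_const.indicator₀ (hmeas j)).restrict,
        ENNReal.tsum_mul_left]
      congr 2 with j
      rw [lintegral_indicator_const₀
          ((hmeas j).mono_ac Measure.restrict_le_self.absolutelyContinuous),
        Measure.restrict_apply' measurableSet_ball, inter_comm]
      rfl
    _ ≤ ∑' j : ℕ, k * t * V * 2⁻¹ ^ j := ENNReal.tsum_le_tsum hterm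
    _ = _ := by
      rw [ENNReal.tsum_mul_left, ENNReal.tsum_geometric_two]
      push_cast
      ring

/-! ### Bounds for the distribution of the maximal function -/

/-- A ball of radius larger than `r` can have average above `2 t` only if `Φ t ≲ φ(r)`; for other
`t`, the set where the maximal function exceeds `2 t` comes from small balls. -/
lemma TailBound.mul_volume_le {K A : ℝ≥0}
    (hφ : ∀ r s, 0 < r → r < s → ENNReal.ofReal (φ s) ≤ A * ENNReal.ofReal (φ r))
    (h : TailBound Φ φ K g) (a : EuclideanSpace ℝ (Fin n)) {r : ℝ} (hr : 0 < r) {t : ℝ≥0∞}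
    (ht0 : 0 < t) (ht : t < ∞) (hlarge : K * A * ENNReal.ofReal (φ r) < Φ t) :
    t * volume {x ∈ Metric.ball a r | 2 * t < maximal g x} ≤
      5 ^ n * ∫⁻ y in Metric.ball a (3 * r), upperPart t g y := by
  refine le_trans ?_ (mul_volume_local_le (upperPart t g) t a r)
  gcongr t * volume ?_
  rintro x ⟨hxa, hx⟩
  obtain ⟨c, ρ, hxc, hlt⟩ := lt_maximal_iff.1 hx
  have hle := mul_volume_le_lintegral_upperPart (g := g) ht.ne c ρ hlt
  refine ⟨hxa, c, ρ, le_of_not_gt fun hρ ↦ hlarge.not_ge ?_, hxc, hle⟩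
  have hρ0 : 0 < ρ := hr.trans hρ
  have hv0 : volume (Metric.ball c ρ) ≠ 0 := (Metric.measure_ball_pos _ _ hρ0).ne'
  have hv : volume (Metric.ball c ρ) ≠ ∞ := measure_ball_lt_top.ne
  have h1 : (t * volume (Metric.ball c ρ)) * Φ t ≤
      (t * volume (Metric.ball c ρ)) * (K * A * ENNReal.ofReal (φ r)) :=
    calc (t * volume (Metric.ball c ρ)) * Φ t
        ≤ Φ t * ∫⁻ y in Metric.ball c ρ, upperPart t g y := by rw [mul_comm]; gcongr
      _ ≤ K * t * (volume (Metric.ball c ρ) * ENNReal.ofReal (φ ρ)) := h c ρ hρ0 t ht0 ht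
      _ ≤ K * t * (volume (Metric.ball c ρ) * (A * ENNReal.ofReal (φ r))) := by
        gcongr; exact hφ r ρ hr hρ
      _ = _ := by ring
  exact (ENNReal.mul_le_mul_iff_right (mul_ne_zero ht0.ne' hv0) (ENNReal.mul_ne_top ht.ne hv)).1 h1

lemma volume_three_mul_le {A : ℝ≥0}
    (hφ : ∀ r s, 0 < r → r < s → ENNReal.ofReal (φ s) ≤ A * ENNReal.ofReal (φ r))
    (a : EuclideanSpace ℝ (Fin n)) {r : ℝ} (hr : 0 < r) :
    volume (Metric.ball a (3 * r)) * ENNReal.ofReal (φ (3 * r)) ≤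
      3 ^ n * A * (volume (Metric.ball a r) * ENNReal.ofReal (φ r)) := by
  rw [volume_ball_mul a r (by norm_num), ENNReal.ofReal_ofNat]
  calc _ ≤ 3 ^ n * volume (Metric.ball a r) * (A * ENNReal.ofReal (φ r)) := by
        gcongr; exact hφ r (3 * r) hr (by linarith)
    _ = _ := by ring

lemma TailBound.mul_volume_maximal_le {K A : ℝ≥0}
    (hφ : ∀ r s, 0 < r → r < s → ENNReal.ofReal (φ s) ≤ A * ENNReal.ofReal (φ r))
    (h : TailBound Φ φ K g) (a : EuclideanSpace ℝ (Fin n)) {r : ℝ} (hr : 0 < r) {t : ℝ≥0∞}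
    (ht0 : 0 < t) (ht : t < ∞) :
    Φ t * volume {x ∈ Metric.ball a r | 2 * t < maximal g x} ≤
      (15 ^ n * K * A : ℝ≥0) * (volume (Metric.ball a r) * ENNReal.ofReal (φ r)) := by
  rcases le_or_gt (Φ t) (K * A * ENNReal.ofReal (φ r)) with hs | hs
  · -- the trivial estimate of the volume by `|B|` is enough for small `Φ t`
    calc Φ t * volume {x ∈ Metric.ball a r | 2 * t < maximal g x}
        ≤ (K * A * ENNReal.ofReal (φ r)) * volume (Metric.ball a r) := by
          gcongr; exact fun x hx ↦ hx.1
      _ = 1 * K * A * (volume (Metric.ball a r) * ENNReal.ofReal (φ r)) := by ring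
      _ ≤ _ := by
        push_cast
        gcongr
        exact one_le_pow₀ (by norm_num)
  · refine (ENNReal.mul_le_mul_iff_right ht0.ne' ht.ne).1 ?_
    calc t * (Φ t * volume {x ∈ Metric.ball a r | 2 * t < maximal g x})
        = Φ t * (t * volume {x ∈ Metric.ball a r | 2 * t < maximal g x}) := by ring
      _ ≤ Φ t * (5 ^ n * ∫⁻ y in Metric.ball a (3 * r), upperPart t g y) := by
        exact mul_le_mul_right (h.mul_volume_le hφ a hr ht0 ht hs) _
      _ = 5 ^ n * (Φ t * ∫⁻ y in Metric.ball a (3 * r), upperPart t g y) := by ring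
      _ ≤ 5 ^ n * (K * t * (3 ^ n * A * (volume (Metric.ball a r) * ENNReal.ofReal (φ r)))) := by
        refine mul_le_mul_right ((h a (3 * r) (by linarith) t ht0 ht).trans ?_) _
        exact mul_le_mul_right (volume_three_mul_le hφ a hr) _
      _ = t * (((5 * 3) ^ n * K * A) *
            (volume (Metric.ball a r) * ENNReal.ofReal (φ r))) := by rw [mul_pow]; ring
      _ = _ := by norm_num

end Tail

section Strong

variable {n : ℕ} {Φ : ℝ≥0∞ → ℝ≥0∞} {φ : ℝ → ℝ} {g : EuclideanSpace ℝ (Fin n) → ℝ≥0∞}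

lemma TailBound.weakModular_maximal (hΦ : IsPhi Φ) {c K A : ℝ≥0} (hc : QuasiSuperlinear Φ c)
    (hK : 1 ≤ K) (hA : 1 ≤ A)
    (hφ : ∀ r s, 0 < r → r < s → ENNReal.ofReal (φ s) ≤ A * ENNReal.ofReal (φ r))
    (h : TailBound Φ φ K g) :
    WeakModular Φ φ (fun x ↦ maximal g x / (2 * c * (15 ^ n * K * A) : ℝ≥0)) := by
  intro a r hr t ht0 ht
  set L : ℝ≥0 := 15 ^ n * K * A with hL
  have hL1 : 1 ≤ L := one_le_mul (one_le_mul (one_le_pow₀ (by norm_num)) hK) hA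
  have hL0 : L ≠ 0 := (zero_lt_one.trans_le hL1).ne'
  have hc0 : c ≠ 0 := (zero_lt_one.trans_le hc.1).ne'
  have hs0 : 0 < (c : ℝ≥0∞) * L * t := by
    exact ENNReal.mul_pos (by simp [hc0, hL0]) ht0.ne'
  have hs : (c : ℝ≥0∞) * L * t < ∞ :=
    ENNReal.mul_lt_top (ENNReal.mul_lt_top ENNReal.coe_lt_top ENNReal.coe_lt_top) ht
  have hset : {x ∈ Metric.ball a r | t < maximal g x / (2 * c * L : ℝ≥0)} =
      {x ∈ Metric.ball a r | 2 * (c * L * t) < maximal g x} := by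
    ext x
    simp only [mem_ofPred_eq]
    rw [ENNReal.lt_div_iff_mul_lt (Or.inl (by simp [hc0, hL0])) (Or.inl ENNReal.coe_ne_top)]
    have : t * ((2 * c * L : ℝ≥0) : ℝ≥0∞) = 2 * (c * L * t) := by push_cast; ring
    rw [this]
  rw [hset]
  refine (ENNReal.mul_le_mul_iff_right (a := (L : ℝ≥0∞)) (by simp [hL0]) ENNReal.coe_ne_top).1 ?_
  calc L * (Φ t * volume {x ∈ Metric.ball a r | 2 * (c * L * t) < maximal g x})
      = L * Φ t * volume {x ∈ Metric.ball a r | 2 * (c * L * t) < maximal g x} := by ring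
    _ ≤ Φ (c * L * t) * volume {x ∈ Metric.ball a r | 2 * (c * L * t) < maximal g x} :=
      mul_le_mul_left (hc.mul_le hΦ hL1 t) _
    _ ≤ _ := h.mul_volume_maximal_le hφ a hr hs0 hs

/-! ### The strong type estimate -/

/-- By `∇₂` the terms `Φ(k ^ j) k ^ (-j)` decay geometrically as `j` decreases, so the sum is
comparable with its largest term. -/
lemma tsum_upperPart_le (hΦ : Monotone Φ) {k : ℝ≥0} (hk : 1 < k)
    (hΦk : ∀ t : ℝ≥0∞, 2 * k * Φ t ≤ Φ (k * t)) {x : EuclideanSpace ℝ (Fin n)} (hx : g x ≠ ∞) :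
    ∑' j : ℤ, Φ (k ^ j : ℝ≥0) * ((k ^ j)⁻¹ : ℝ≥0) * upperPart (k ^ j : ℝ≥0) g x ≤
      2 * k * Φ (g x) := by
  obtain ⟨u, hu⟩ : ∃ u : ℝ≥0, (u : ℝ≥0∞) = g x := ⟨_, ENNReal.coe_toNNReal hx⟩
  have hk0 : k ≠ 0 := (zero_lt_one.trans hk).ne'
  rcases eq_or_ne u 0 with rfl | hu0
  · rw [ENNReal.coe_zero] at hu
    simp [upperPart, ← hu]
  obtain ⟨J, hJ1, hJ2⟩ := exists_mem_Ioc_zpow (pos_iff_ne_zero.2 hu0) hk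
  have hinj : Function.Injective (fun i : ℕ ↦ J - (i : ℤ)) := fun i i' h ↦ by
    simpa using h
  -- only the terms with `j ≤ J` are nonzero
  have hsupp : (Function.support fun j : ℤ ↦
      Φ (k ^ j : ℝ≥0) * ((k ^ j)⁻¹ : ℝ≥0) * upperPart (k ^ j : ℝ≥0) g x) ⊆
      range (fun i : ℕ ↦ J - (i : ℤ)) := by
    intro j hj
    by_contra hcon
    have hjJ : J + 1 ≤ j := by
      by_contra hlt
      exact hcon ⟨(J - j).toNat, by simp only; omega⟩
    refine hj ?_
    simp only
    rw [upperPart_of_le, mul_zero]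
    rw [← hu]
    exact_mod_cast hJ2.trans (zpow_le_zpow_right₀ hk.le hjJ)
  rw [← hinj.tsum_eq hsupp]
  have hterm (i : ℕ) : Φ (k ^ (J - (i : ℤ)) : ℝ≥0) * ((k ^ (J - (i : ℤ)))⁻¹ : ℝ≥0) *
      upperPart (k ^ (J - (i : ℤ)) : ℝ≥0) g x ≤ k * Φ (g x) * 2⁻¹ ^ i := by
    have hup : upperPart (k ^ (J - (i : ℤ)) : ℝ≥0) g x ≤ u := by
      rw [hu]; exact indicator_le_self _ g x
    have hinv : (k ^ (J - (i : ℤ)))⁻¹ * u ≤ k * k ^ i := by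
      calc (k ^ (J - (i : ℤ)))⁻¹ * u ≤ (k ^ (J - (i : ℤ)))⁻¹ * k ^ (J + 1) := by gcongr
        _ = k * k ^ i := by
          rw [← zpow_neg, ← zpow_add₀ hk0, ← zpow_natCast, ← zpow_one_add₀ hk0]
          congr 1
          ring
    have hpow : (k : ℝ≥0∞) ^ i * ((k ^ (J - (i : ℤ)) : ℝ≥0) : ℝ≥0∞) ≤ g x := by
      rw [← hu]
      have : k ^ i * k ^ (J - (i : ℤ)) = k ^ J := by
        rw [← zpow_natCast, ← zpow_add₀ hk0]
        congr 1
        ring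
      exact_mod_cast this.le.trans hJ1.le
    have h2 : (2⁻¹ : ℝ≥0∞) ^ i * 2 ^ i = 1 := by
      rw [← mul_pow, ENNReal.inv_mul_cancel (by simp) (by simp), one_pow]
    calc Φ (k ^ (J - (i : ℤ)) : ℝ≥0) * ((k ^ (J - (i : ℤ)))⁻¹ : ℝ≥0) *
          upperPart (k ^ (J - (i : ℤ)) : ℝ≥0) g x
        ≤ Φ (k ^ (J - (i : ℤ)) : ℝ≥0) * ((k ^ (J - (i : ℤ)))⁻¹ : ℝ≥0) * u := by gcongr
      _ = Φ (k ^ (J - (i : ℤ)) : ℝ≥0) * (((k ^ (J - (i : ℤ)))⁻¹ * u : ℝ≥0) : ℝ≥0∞) := by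
        rw [mul_assoc, ENNReal.coe_mul]
      _ ≤ Φ (k ^ (J - (i : ℤ)) : ℝ≥0) * ((k * k ^ i : ℝ≥0) : ℝ≥0∞) := by
        gcongr
      _ = k * ((2 * k) ^ i * Φ (k ^ (J - (i : ℤ)) : ℝ≥0)) * 2⁻¹ ^ i := by
        rw [mul_pow, ← mul_one (Φ _ * _), ← h2]
        push_cast
        ring
      _ ≤ k * Φ (g x) * 2⁻¹ ^ i :=
        mul_le_mul_left (mul_le_mul_right ((pow_mul_le_of_nabla hΦk _ i).trans (hΦ hpow)) _) _
  calc _ ≤ ∑' i : ℕ, k * Φ (g x) * 2⁻¹ ^ i := ENNReal.tsum_le_tsum hterm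
    _ = _ := by rw [ENNReal.tsum_mul_left, ENNReal.tsum_geometric_two]; ring

/-- Discrete layer cake bound for `Φ`, in which only the levels with `Φ(k ^ j)` above a given
threshold `N` enter. -/
lemma le_add_tsum_indicator (hΦ : IsPhi Φ) {c : ℝ≥0} (hc : QuasiSuperlinear Φ c) {k : ℝ≥0}
    (hk : 1 < k) (N : ℝ≥0∞) (G : EuclideanSpace ℝ (Fin n) → ℝ≥0∞)
    (x : EuclideanSpace ℝ (Fin n)) :
    Φ (G x / (2 * k : ℝ≥0)) ≤ N + ∑' j : {j : ℤ // N < Φ (k ^ j : ℝ≥0)},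
      {y | 2 * (k ^ j.1 : ℝ≥0) < G y}.indicator (fun _ ↦ Φ (k ^ j.1 : ℝ≥0)) x := by
  have hk0 : k ≠ 0 := (zero_lt_one.trans hk).ne'
  have hle (j : ℤ) (hj : 2 * (k ^ j : ℝ≥0) < G x) : Φ (k ^ j : ℝ≥0) ≤
      N + ∑' j : {j : ℤ // N < Φ (k ^ j : ℝ≥0)},
      {y | 2 * (k ^ j.1 : ℝ≥0) < G y}.indicator (fun _ ↦ Φ (k ^ j.1 : ℝ≥0)) x := by
    rcases le_or_gt (Φ (k ^ j : ℝ≥0)) N with h | h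
    · exact h.trans le_self_add
    · refine le_trans ?_ (le_add_left (ENNReal.le_tsum ⟨j, h⟩))
      rw [indicator_of_mem (s := {y | 2 * (k ^ j : ℝ≥0) < G y}) hj]
  rcases eq_or_ne (G x) ∞ with hx | hx
  · -- all levels are active and `Φ` is unbounded, so the sum diverges
    refine le_top.trans (le_of_eq (ENNReal.eq_top_of_forall_nnreal_le fun m ↦ ?_).symm)
    obtain ⟨t, ht, hmt⟩ := hc.exists_lt hΦ (N := m) ENNReal.coe_ne_top
    lift t to ℝ≥0 using ht
    obtain ⟨j, hj⟩ := pow_unbounded_of_one_lt t hk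
    refine (hmt.le.trans (hΦ.monotone ?_)).trans (hle j ?_)
    · rw [zpow_natCast]
      exact_mod_cast hj.le
    · rw [hx]
      exact ENNReal.mul_lt_top (by simp) ENNReal.coe_lt_top
  obtain ⟨u, hu⟩ : ∃ u : ℝ≥0, (u : ℝ≥0∞) = G x := ⟨_, ENNReal.coe_toNNReal hx⟩
  rcases eq_or_ne u 0 with rfl | hu0
  · simp [← hu, hΦ.map_zero]
  have hu2 : 0 < u / 2 := by positivity
  obtain ⟨J, hJ1, hJ2⟩ := exists_mem_Ioc_zpow hu2 hk
  refine le_trans (hΦ.monotone ?_) (hle J ?_)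
  · rw [← hu, ← ENNReal.coe_div (by simpa using hk0)]
    refine ENNReal.coe_le_coe.2 ?_
    rw [div_le_iff₀ (by positivity)]
    rw [div_le_iff₀ (by positivity), zpow_add_one₀ hk0] at hJ2
    calc u ≤ _ := hJ2
      _ = _ := by ring
  · rw [← hu]
    rw [lt_div_iff₀' (by positivity)] at hJ1
    exact_mod_cast hJ1

lemma StrongModular.lintegral_maximal_le (hΦ : IsPhi Φ) {c K A k : ℝ≥0}
    (hc : QuasiSuperlinear Φ c) (hk : 1 < k) (hΦk : ∀ t : ℝ≥0∞, 2 * k * Φ t ≤ Φ (k * t))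
    (hφ : ∀ r s, 0 < r → r < s → ENNReal.ofReal (φ s) ≤ A * ENNReal.ofReal (φ r))
    (hg : AEMeasurable g) (hfin : ∀ x, g x ≠ ∞) (htail : TailBound Φ φ K g)
    (h : StrongModular Φ φ g) (a : EuclideanSpace ℝ (Fin n)) {r : ℝ} (hr : 0 < r) :
    ∫⁻ x in Metric.ball a r, Φ (maximal g x / (2 * k : ℝ≥0)) ≤
      (K * A + 15 ^ n * (2 * k) * A : ℝ≥0) *
        (volume (Metric.ball a r) * ENNReal.ofReal (φ r)) := by
  set N := K * A * ENNReal.ofReal (φ r) with hN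
  have hk0 : k ≠ 0 := (zero_lt_one.trans hk).ne'
  have hmeas (s : ℝ≥0∞) : MeasurableSet {y | s < maximal g y} :=
    measurableSet_lt measurable_const (measurable_maximal g)
  have hlevel (j : {j : ℤ // N < Φ (k ^ j : ℝ≥0)}) :
      ∫⁻ x in Metric.ball a r, {y | 2 * (k ^ j.1 : ℝ≥0) < maximal g y}.indicator
        (fun _ ↦ Φ (k ^ j.1 : ℝ≥0)) x ≤
      5 ^ n * (Φ (k ^ j.1 : ℝ≥0) * ((k ^ j.1)⁻¹ : ℝ≥0) *
        ∫⁻ x in Metric.ball a (3 * r), upperPart (k ^ j.1 : ℝ≥0) g x) := by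
    have hkj : k ^ j.1 ≠ 0 := zpow_ne_zero _ hk0
    have h1 := htail.mul_volume_le hφ a hr (t := (k ^ j.1 : ℝ≥0))
      (by exact_mod_cast pos_iff_ne_zero.2 hkj) ENNReal.coe_lt_top j.2
    rw [lintegral_indicator_const (hmeas _), Measure.restrict_apply' measurableSet_ball, inter_comm]
    set V := volume (Metric.ball a r ∩ {y | 2 * (k ^ j.1 : ℝ≥0) < maximal g y})
    have hcancel : (((k ^ j.1)⁻¹ : ℝ≥0) : ℝ≥0∞) * (k ^ j.1 : ℝ≥0) = 1 := by
      rw [← ENNReal.coe_mul, inv_mul_cancel₀ hkj, ENNReal.coe_one]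
    calc Φ (k ^ j.1 : ℝ≥0) * V
        = Φ (k ^ j.1 : ℝ≥0) * ((k ^ j.1)⁻¹ : ℝ≥0) * ((k ^ j.1 : ℝ≥0) * V) := by
          rw [mul_assoc, ← mul_assoc (((k ^ j.1)⁻¹ : ℝ≥0) : ℝ≥0∞), hcancel, one_mul]
      _ ≤ Φ (k ^ j.1 : ℝ≥0) * ((k ^ j.1)⁻¹ : ℝ≥0) *
          (5 ^ n * ∫⁻ x in Metric.ball a (3 * r), upperPart (k ^ j.1 : ℝ≥0) g x) :=
        mul_le_mul_right h1 _
      _ = _ := by ring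
  calc ∫⁻ x in Metric.ball a r, Φ (maximal g x / (2 * k : ℝ≥0))
      ≤ ∫⁻ x in Metric.ball a r, (N + ∑' j : {j : ℤ // N < Φ (k ^ j : ℝ≥0)},
          {y | 2 * (k ^ j.1 : ℝ≥0) < maximal g y}.indicator
            (fun _ ↦ Φ (k ^ j.1 : ℝ≥0)) x) :=
        lintegral_mono fun x ↦ le_add_tsum_indicator hΦ hc hk N (maximal g) x
    _ = N * volume (Metric.ball a r) + ∑' j : {j : ℤ // N < Φ (k ^ j : ℝ≥0)},
          ∫⁻ x in Metric.ball a r, {y | 2 * (k ^ j.1 : ℝ≥0) < maximal g y}.indicator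
            (fun _ ↦ Φ (k ^ j.1 : ℝ≥0)) x := by
      rw [lintegral_add_left measurable_const, setLIntegral_const, lintegral_tsum
        fun j ↦ (measurable_const.indicator (hmeas _)).aemeasurable]
    _ ≤ N * volume (Metric.ball a r) + ∑' j : {j : ℤ // N < Φ (k ^ j : ℝ≥0)},
          5 ^ n * (Φ (k ^ j.1 : ℝ≥0) * ((k ^ j.1)⁻¹ : ℝ≥0) *
            ∫⁻ x in Metric.ball a (3 * r), upperPart (k ^ j.1 : ℝ≥0) g x) :=
      add_le_add_right (ENNReal.tsum_le_tsum hlevel) _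
    _ ≤ N * volume (Metric.ball a r) + ∑' j : ℤ,
          5 ^ n * (Φ (k ^ j : ℝ≥0) * ((k ^ j)⁻¹ : ℝ≥0) *
            ∫⁻ x in Metric.ball a (3 * r), upperPart (k ^ j : ℝ≥0) g x) :=
      add_le_add_right (ENNReal.tsum_comp_le_tsum_of_injective Subtype.val_injective
        fun j : ℤ ↦ 5 ^ n * (Φ (k ^ j : ℝ≥0) * ((k ^ j)⁻¹ : ℝ≥0) *
            ∫⁻ x in Metric.ball a (3 * r), upperPart (k ^ j : ℝ≥0) g x)) _
    _ = N * volume (Metric.ball a r) + 5 ^ n * ∫⁻ x in Metric.ball a (3 * r), ∑' j : ℤ,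
          Φ (k ^ j : ℝ≥0) * ((k ^ j)⁻¹ : ℝ≥0) * upperPart (k ^ j : ℝ≥0) g x := by
      rw [ENNReal.tsum_mul_left, lintegral_tsum
        fun j ↦ (aemeasurable_upperPart hg).restrict.const_mul _]
      simp only [lintegral_const_mul'' _ (aemeasurable_upperPart hg).restrict]
    _ ≤ N * volume (Metric.ball a r) +
          5 ^ n * ∫⁻ x in Metric.ball a (3 * r), 2 * k * Φ (g x) := by
      gcongr with x
      exact tsum_upperPart_le hΦ.monotone hk hΦk (hfin x)
    _ ≤ N * volume (Metric.ball a r) + 5 ^ n * (2 * k *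
          (3 ^ n * A * (volume (Metric.ball a r) * ENNReal.ofReal (φ r)))) := by
      rw [lintegral_const_mul' _ _ (ENNReal.mul_ne_top (by simp) ENNReal.coe_ne_top)]
      have := (h a (3 * r) (by linarith)).trans (volume_three_mul_le hφ a hr)
      gcongr
    _ = (K * A + (5 * 3) ^ n * (2 * k) * A) *
          (volume (Metric.ball a r) * ENNReal.ofReal (φ r)) := by
      rw [hN, mul_pow]; ring
    _ = _ := by norm_num

lemma StrongModular.strongModular_maximal (hΦ : IsPhi Φ) {c K A k : ℝ≥0}
    (hc : QuasiSuperlinear Φ c) (hk : 1 < k) (hΦk : ∀ t : ℝ≥0∞, 2 * k * Φ t ≤ Φ (k * t))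
    (hK : 1 ≤ K) (hA : 1 ≤ A)
    (hφ : ∀ r s, 0 < r → r < s → ENNReal.ofReal (φ s) ≤ A * ENNReal.ofReal (φ r))
    (hg : AEMeasurable g) (hfin : ∀ x, g x ≠ ∞) (htail : TailBound Φ φ K g)
    (h : StrongModular Φ φ g) :
    StrongModular Φ φ (fun x ↦ maximal g x /
      (2 * k * (c * (K * A + 15 ^ n * (2 * k) * A)) : ℝ≥0)) := by
  intro a r hr
  have hmain := h.lintegral_maximal_le hΦ hc hk hΦk hφ hg hfin htail a hr
  set L : ℝ≥0 := K * A + 15 ^ n * (2 * k) * A with hL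
  have hL1 : 1 ≤ L := (one_le_mul hK hA).trans le_self_add
  have hL0 : L ≠ 0 := (zero_lt_one.trans_le hL1).ne'
  have hc0 : c ≠ 0 := (zero_lt_one.trans_le hc.1).ne'
  refine (ENNReal.mul_le_mul_iff_right (a := (L : ℝ≥0∞)) (by simp [hL0]) ENNReal.coe_ne_top).1 ?_
  rw [← lintegral_const_mul' _ _ ENNReal.coe_ne_top]
  refine le_trans (lintegral_mono fun x ↦ ?_) hmain
  refine (hc.mul_le hΦ hL1 _).trans_eq ?_
  congr 1
  have hcL : (c * L : ℝ≥0) ≠ 0 := mul_ne_zero hc0 hL0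
  change (c : ℝ≥0∞) * L * (maximal g x / (2 * k * (c * L) : ℝ≥0)) = _
  rw [← mul_div_assoc, ← ENNReal.coe_mul, mul_comm (2 * k), ENNReal.coe_mul (c * L),
    ENNReal.mul_div_mul_left _ _ (by simpa using hcL) ENNReal.coe_ne_top]

end Strong

/-! ### Boundedness of the maximal operator -/

section Bounded

variable {n : ℕ} {φ : ℝ → ℝ}

lemma GDec.exists_ofReal_le (hφ : GDec n φ) : ∃ A : ℝ≥0, 1 ≤ A ∧
    ∀ r s, 0 < r → r < s → ENNReal.ofReal (φ s) ≤ A * ENNReal.ofReal (φ r) := by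
  obtain ⟨hpos, C, hC, h⟩ := hφ
  refine ⟨max 1 C.toNNReal, le_max_left _ _, fun r s hr hrs ↦ ?_⟩
  calc ENNReal.ofReal (φ s) ≤ ENNReal.ofReal (C * φ r) :=
        ENNReal.ofReal_le_ofReal (h r s hr hrs).1
    _ = C.toNNReal * ENNReal.ofReal (φ r) := ENNReal.ofReal_mul hC.le
    _ ≤ _ := by gcongr; exact le_max_right _ _

/-- Homogeneity: a bound at every scale `lam` above the norm `N` is a bound by the norm. -/
lemma le_mul_of_forall_gt {C : ℝ≥0} (hC : 0 < C) {N N' : ℝ≥0∞} (hN : N < ∞)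
    (h : ∀ lam, N < lam → lam < ∞ → N' ≤ C * lam) : N' < ∞ ∧ N' ≤ C * N := by
  have hC0 : (C : ℝ≥0∞) ≠ 0 := by simpa using hC.ne'
  have hle : N' ≤ C * N := by
    rw [mul_comm, ← ENNReal.div_le_iff hC0 ENNReal.coe_ne_top]
    refine le_of_forall_gt_imp_ge_of_dense fun lam hlam ↦ ?_
    rcases eq_or_ne lam ∞ with rfl | hlam'
    · exact le_top
    · rw [ENNReal.div_le_iff hC0 ENNReal.coe_ne_top, mul_comm]
      exact h lam hlam (lt_top_iff_ne_top.2 hlam')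
  exact ⟨hle.trans_lt (ENNReal.mul_lt_top ENNReal.coe_lt_top hN), hle⟩

lemma maximal_div_div {𝕜 : Type*} [ENorm 𝕜] (f : EuclideanSpace ℝ (Fin n) → 𝕜) {lam : ℝ≥0∞}
    (h0 : lam ≠ 0) (h1 : lam ≠ ∞) (C : ℝ≥0) :
    (fun x ↦ maximal (fun y ↦ ‖f y‖ₑ / lam) x / C) = fun x ↦ ‖maximal f x‖ₑ / (C * lam) := by
  ext x
  rw [maximal_div f h0, enorm_eq_self, mul_comm (C : ℝ≥0∞)]
  simp only [div_eq_mul_inv]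
  rw [ENNReal.mul_inv (Or.inl h0) (Or.inl h1), mul_assoc]

end Bounded

end OrliczMorrey

theorem mainTheorem2 {𝕜 : Type*} [RCLike 𝕜] (n : ℕ) (hn : 1 ≤ n)
    (Φ : ENNReal → ENNReal) (hΦ : OrliczMorrey.IsGenYoung Φ)
    (φ : ℝ → ℝ) (hφ : OrliczMorrey.GDec n φ) :
    (∃ C : NNReal, 0 < C ∧ ∀ f : EuclideanSpace ℝ (Fin n) → 𝕜,
      OrliczMorrey.MemOM Φ φ f →
        OrliczMorrey.MemWeakOM Φ φ (OrliczMorrey.maximal f) ∧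
        OrliczMorrey.omWeakNorm Φ φ (OrliczMorrey.maximal f) ≤ C * OrliczMorrey.omNorm Φ φ f) ∧
    (OrliczMorrey.Nabla2 Φ →
      (∃ C : NNReal, 0 < C ∧ ∀ f : EuclideanSpace ℝ (Fin n) → 𝕜,
        OrliczMorrey.MemOM Φ φ f →
          OrliczMorrey.MemOM Φ φ (OrliczMorrey.maximal f) ∧
          OrliczMorrey.omNorm Φ φ (OrliczMorrey.maximal f) ≤ C * OrliczMorrey.omNorm Φ φ f) ∧
      (∃ C : NNReal, 0 < C ∧ ∀ f : EuclideanSpace ℝ (Fin n) → 𝕜,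
        OrliczMorrey.MemWeakOM Φ φ f →
          OrliczMorrey.MemWeakOM Φ φ (OrliczMorrey.maximal f) ∧
          OrliczMorrey.omWeakNorm Φ φ (OrliczMorrey.maximal f) ≤
            C * OrliczMorrey.omWeakNorm Φ φ f)) := by
  open OrliczMorrey in
  obtain ⟨c, hc⟩ := hΦ.exists_quasiSuperlinear
  obtain ⟨A, hA, hφA⟩ := hφ.exists_ofReal_le
  have hΦ' : IsPhi Φ := hΦ.1
  have hc0 : 0 < c := zero_lt_one.trans_le hc.1
  have hA0 : 0 < A := zero_lt_one.trans_le hA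
  have hmeas (f : EuclideanSpace ℝ (Fin n) → 𝕜) : AEStronglyMeasurable (maximal f) volume :=
    (measurable_maximal f).aestronglyMeasurable
  have hfin (f : EuclideanSpace ℝ (Fin n) → 𝕜) {lam : ℝ≥0∞} (h0 : lam ≠ 0)
      (x : EuclideanSpace ℝ (Fin n)) : ‖f x‖ₑ / lam ≠ ∞ := ENNReal.div_ne_top enorm_ne_top h0
  refine ⟨⟨2 * c * (15 ^ n * 1 * A) * c, by positivity, fun f hf ↦ ?_⟩, fun hnabla ↦ ?_⟩
  · obtain ⟨h1, h2⟩ := le_mul_of_forall_gt (N' := omWeakNorm Φ φ (maximal f))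
      (C := 2 * c * (15 ^ n * 1 * A) * c) (by positivity) hf.2 fun lam hlam hlam' ↦ by
        have h0 : lam ≠ 0 := (zero_le.trans_lt hlam).ne'
        have hcl0 : (c : ℝ≥0∞) * lam ≠ 0 := mul_ne_zero (by simpa using hc0.ne') h0
        have hcl : (c : ℝ≥0∞) * lam ≠ ∞ := ENNReal.mul_ne_top ENNReal.coe_ne_top hlam'.ne
        have hs := StrongModular.of_omNorm_lt hΦ'.monotone hφ.1 hlam
        -- the tail bound holds for `f / (c lam)`, since its modular is taken after dilation by `c`
        have he : (fun x ↦ ‖f x‖ₑ / lam) = fun x ↦ c * (‖f x‖ₑ / (c * lam)) := by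
          ext x
          rw [← mul_div_assoc, ENNReal.mul_div_mul_left _ _ (by simpa using hc0.ne')
            ENNReal.coe_ne_top]
        rw [he] at hs
        have hw := (hs.tailBound (hf.1.enorm.div_const _) hc).weakModular_maximal hΦ' hc le_rfl
          hA hφA
        rw [maximal_div_div f hcl0 hcl] at hw
        rw [ENNReal.coe_mul, mul_assoc]
        refine hw.omWeakNorm_le hφ.1 ?_ ?_
        · exact ENNReal.mul_pos (by simp [hc0.ne', hA0.ne']) hcl0
        · exact ENNReal.mul_lt_top ENNReal.coe_lt_top (lt_top_iff_ne_top.2 hcl)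
    exact ⟨⟨hmeas f, h1⟩, h2⟩
  obtain ⟨-, k, hk, hk'⟩ := hnabla
  have hΦk := mul_le_of_nabla hΦ' hk hk'
  have hk0 : 0 < k := zero_lt_one.trans hk
  have h2k : 1 ≤ 2 * k := hk.le.trans (by rw [two_mul]; exact le_self_add)
  constructor
  · refine ⟨2 * k * (c * (2 * k * A + 15 ^ n * (2 * k) * A)), by positivity, fun f hf ↦ ?_⟩
    obtain ⟨h1, h2⟩ := le_mul_of_forall_gt (N' := omNorm Φ φ (maximal f))
      (C := 2 * k * (c * (2 * k * A + 15 ^ n * (2 * k) * A))) (by positivity) hf.2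
      fun lam hlam hlam' ↦ by
        have h0 : lam ≠ 0 := (zero_le.trans_lt hlam).ne'
        have hs := StrongModular.of_omNorm_lt hΦ'.monotone hφ.1 hlam
        have hg : AEMeasurable fun x ↦ ‖f x‖ₑ / lam := hf.1.enorm.div_const _
        -- under `∇₂` the weak condition suffices for the tail bound, with no dilation
        have ht := (hs.weakModular hΦ'.monotone hg).tailBound hk hΦk hg (hfin f h0)
        have hM := hs.strongModular_maximal hΦ' hc hk hΦk h2k hA hφA hg (hfin f h0) ht
        rw [maximal_div_div f h0 hlam'.ne] at hM
        refine hM.omNorm_le hφ.1 ?_ ?_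
        · exact ENNReal.mul_pos (by simp [hc0.ne', hA0.ne', hk0.ne']) h0
        · exact ENNReal.mul_lt_top ENNReal.coe_lt_top hlam'
    exact ⟨⟨hmeas f, h1⟩, h2⟩
  · refine ⟨2 * c * (15 ^ n * (2 * k) * A), by positivity, fun f hf ↦ ?_⟩
    obtain ⟨h1, h2⟩ := le_mul_of_forall_gt (N' := omWeakNorm Φ φ (maximal f))
      (C := 2 * c * (15 ^ n * (2 * k) * A)) (by positivity) hf.2
      fun lam hlam hlam' ↦ by
        have h0 : lam ≠ 0 := (zero_le.trans_lt hlam).ne'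
        have hs := WeakModular.of_omWeakNorm_lt hφ.1 hlam
        have hg : AEMeasurable fun x ↦ ‖f x‖ₑ / lam := hf.1.enorm.div_const _
        have hw := (hs.tailBound hk hΦk hg (hfin f h0)).weakModular_maximal hΦ' hc h2k hA hφA
        rw [maximal_div_div f h0 hlam'.ne] at hw
        refine hw.omWeakNorm_le hφ.1 ?_ ?_
        · exact ENNReal.mul_pos (by simp [hc0.ne', hA0.ne', hk0.ne']) h0
        · exact ENNReal.mul_lt_top ENNReal.coe_lt_top hlam'
    exact ⟨⟨hmeas f, h1⟩, h2⟩
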